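/- Throughout, C*-algebras are complex and not necessarily unital. An ideal of a C*-algebra $A$ is an additive subgroup $I \subseteq A$ such that $aI \cup Ia \subseteq I$ for all $a \in A$; it need not be norm-closed, nor closed under scalar multiplication. For an ideal $J$, let $J^2$ denote the additive subgroup generated by $\{xy : x, y \in J\}$. An ideal $I \subseteq A$ is called semiprime if for every ideal $J \subseteq A$ with $J^2 \subseteq I$ one has $J \subseteq I$. Let $A$ be a C*-algebra, let $I \subseteq A$ be a semiprime ideal, and let $B \subseteq A$ be a C*-subalgebra (a norm-closed $*$-subalgebra, not necessarily containing a unit of $A$). Then $I \cap B$ is a semiprime ideal of $B$. -/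

import Mathlib

namespace TwoSidedIdeal

/-- The product `I J` of two ideals of a (possibly non-unital) ring: the additive subgroup
generated by all products `x * y` with `x ∈ I` and `y ∈ J`. -/
def prodAddSubgroup {R : Type*} [NonUnitalRing R] (I J : TwoSidedIdeal R) : AddSubgroup R :=
  AddSubgroup.closure {z : R | ∃ x ∈ I, ∃ y ∈ J, x * y = z}

/-- A two-sided ideal `I` of a (possibly non-unital) ring is semiprime if every two-sided ideal `J`
with `J ^ 2 ⊆ I` satisfies `J ⊆ I`. The ideal `I = R` is allowed. Ideals are additive subgroups
absorbing multiplication on both sides; in an algebra they need be neither closed under scalar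
multiplication nor topologically closed. -/
def IsSemiprime {R : Type*} [NonUnitalRing R] (I : TwoSidedIdeal R) : Prop :=
  ∀ J : TwoSidedIdeal R, (J.prodAddSubgroup J : Set R) ⊆ I → J ≤ I

end TwoSidedIdeal

open scoped NNReal
open Filter Topology

namespace Real

/-! If `K` is an ideal of `B` with `K² ⊆ I` and `b ∈ K`, then `b(b*b) ∈ K² ⊆ I`, so `(b*b)² ∈ I`. A
semiprime ideal of `A` is closed under positive powers of its positive elements, so `(b*b)^(1/4) ∈
I`, and `b = u(b*b)^(1/4)` with `u ∈ A`. Powers descend because `d ∈ I` forces `eAe ⊆ I` for `e =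
d^(5/8)`, whence semiprimeness gives `AeA ⊆ I`. Both halves rest on the factorization
`exists_eq_mul_nnrpow`. -/

lemma rpow_mul_le_add_mul_rpow {t δ β : ℝ} (ht : 0 ≤ t) (hδ : 0 < δ) (hβ : 0 ≤ β) (hβ1 : β ≤ 1) :
    t ^ β * δ ≤ (t + δ) * δ ^ β := by
  have h1 : t ^ β ≤ (t + δ) ^ β := rpow_le_rpow ht (by linarith) hβ
  have h2 : δ ^ (1 - β) ≤ (t + δ) ^ (1 - β) := rpow_le_rpow hδ.le (by linarith) (by linarith)
  have e1 : δ ^ (1 - β) * δ ^ β = δ := by rw [← rpow_add hδ]; simp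
  have e2 : (t + δ) ^ β * (t + δ) ^ (1 - β) = t + δ := by
    rw [← rpow_add (by linarith)]; simp
  calc t ^ β * δ = t ^ β * δ ^ (1 - β) * δ ^ β := by rw [mul_assoc, e1]
    _ ≤ (t + δ) ^ β * (t + δ) ^ (1 - β) * δ ^ β := by gcongr
    _ = _ := by rw [e2]

/-- The functions `t ↦ √t * t ^ (1 - α) / (t + δ)` converge uniformly to `t ↦ t ^ (1 / 2 - α)`. -/
lemma abs_sqrt_mul_rpow_div_sub_le {t δ α : ℝ} (ht : 0 ≤ t) (hδ : 0 < δ) (hα : 0 < α)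
    (hα2 : α < 1 / 2) :
    |√t * (t ^ (1 - α) / (t + δ)) - t ^ (1 / 2 - α)| ≤ δ ^ (1 / 2 - α) := by
  have htδ : 0 < t + δ := by linarith
  have h1 : √t * t ^ (1 - α) = t ^ (1 / 2 - α) * t := by
    rw [sqrt_eq_rpow, ← rpow_add_of_nonneg ht (by norm_num) (by linarith)]
    nth_rw 3 [← rpow_one t]
    rw [← rpow_add_of_nonneg ht (by linarith) (by norm_num)]
    ring_nf
  have h2 : √t * (t ^ (1 - α) / (t + δ)) - t ^ (1 / 2 - α) = -(t ^ (1 / 2 - α) * δ / (t + δ)) := by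
    rw [← mul_div_assoc, h1]; field_simp; ring
  have h3 : 0 ≤ t ^ (1 / 2 - α) * δ / (t + δ) := by positivity
  rw [h2, abs_neg, abs_of_nonneg h3, div_le_iff₀ htδ, mul_comm _ (t + δ)]
  exact rpow_mul_le_add_mul_rpow ht hδ (by linarith) (by linarith)

end Real

/-! ### Factorization through powers of a dominating positive element -/

namespace CStarAlgebra

section Factorization

variable {A : Type*} [NonUnitalCStarAlgebra A] [PartialOrder A] [StarOrderedRing A]

/-- C*-identity: `g(a) x*x g(a) ≤ g(a) a g(a)`, reducing the norm to a scalar supremum. -/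
lemma norm_mul_cfcₙ_sq_le {x a : A} (ha : 0 ≤ a) (hxa : star x * x ≤ a) {g : ℝ → ℝ}
    (hg : Continuous fun t : Set.Ici (0 : ℝ) ↦ g t) (hg0 : g 0 = 0) {C : ℝ}
    (hC : ∀ t, 0 ≤ t → t * g t ^ 2 ≤ C) :
    ‖x * cfcₙ g a‖ ^ 2 ≤ C := by
  have hspec : ∀ t ∈ quasispectrum ℝ a, 0 ≤ t := fun t ht ↦
    quasispectrum_nonneg_of_nonneg a ha t ht
  have hgc : ContinuousOn g (quasispectrum ℝ a) :=
    (continuousOn_iff_continuous_domRestrict.2 hg).mono hspec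
  have hsa : star (cfcₙ g a) = cfcₙ g a := (cfcₙ_predicate g a : IsSelfAdjoint _)
  have hle : star (x * cfcₙ g a) * (x * cfcₙ g a) ≤ star (cfcₙ g a) * a * cfcₙ g a := by
    have := star_left_conjugate_le_conjugate hxa (cfcₙ g a)
    simpa [mul_assoc] using this
  have heq : star (cfcₙ g a) * a * cfcₙ g a = cfcₙ (fun t ↦ g t * t * g t) a := by
    rw [hsa, cfcₙ_mul (fun t ↦ g t * t) g a, cfcₙ_mul g (fun t ↦ t) a, cfcₙ_id' ℝ a]
  rw [sq, ← CStarRing.norm_star_mul_self]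
  refine (norm_le_norm_of_nonneg_of_le (star_mul_self_nonneg _) (hle.trans_eq heq)).trans
    (norm_cfcₙ_le fun t ht ↦ ?_)
  have ht0 := hspec t ht
  have h1 := hC t ht0
  rw [show g t * t * g t = t * g t ^ 2 by ring, Real.norm_of_nonneg (by positivity)]
  exact h1

lemma norm_sub_mul_cfcₙ_sq_le {x a : A} (ha : 0 ≤ a) (hxa : star x * x ≤ a) {g : ℝ → ℝ}
    (hg : Continuous fun t : Set.Ici (0 : ℝ) ↦ g t) (hg0 : g 0 = 0) {C : ℝ}
    (hC : ∀ t, 0 ≤ t → t * (1 - g t) ^ 2 ≤ C) :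
    ‖x - x * cfcₙ g a‖ ^ 2 ≤ C := by
  have hspec : ∀ t ∈ quasispectrum ℝ a, 0 ≤ t := fun t ht ↦
    quasispectrum_nonneg_of_nonneg a ha t ht
  have hgc : ContinuousOn g (quasispectrum ℝ a) :=
    (continuousOn_iff_continuous_domRestrict.2 hg).mono hspec
  have hsa : star (cfcₙ g a) = cfcₙ g a := (cfcₙ_predicate g a : IsSelfAdjoint _)
  set h := cfcₙ g a with hh
  have hle : star (x - x * h) * (x - x * h) ≤ (a - a * h) - h * (a - a * h) := by
    -- Conjugation by `1 - h` without a unit: write `a - x*x = z*z` and use `z - zh`.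
    obtain ⟨z, hz⟩ := nonneg_iff_eq_star_mul_self.1 (sub_nonneg.2 hxa)
    have h0 : 0 ≤ star (z - z * h) * (z - z * h) := star_mul_self_nonneg _
    have h1 : star (z - z * h) * (z - z * h)
        = (star z * z - star z * z * h) - h * (star z * z - star z * z * h) := by
      simp only [star_sub, star_mul, hsa]; noncomm_ring
    rw [← sub_nonneg]
    refine h0.trans_eq ?_
    rw [h1, ← hz]
    simp only [star_sub, star_mul, hsa]
    noncomm_ring
  have heq : (a - a * h) - h * (a - a * h)
      = cfcₙ (fun t ↦ (t - t * g t) - g t * (t - t * g t)) a := by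
    rw [cfcₙ_sub (fun t ↦ t - t * g t) (fun t ↦ g t * (t - t * g t)) a,
      cfcₙ_mul g (fun t ↦ t - t * g t) a, cfcₙ_sub (fun t ↦ t) (fun t ↦ t * g t) a,
      cfcₙ_mul (fun t ↦ t) g a, cfcₙ_id' ℝ a]
  rw [sq, ← CStarRing.norm_star_mul_self]
  refine (norm_le_norm_of_nonneg_of_le (star_mul_self_nonneg _) (hle.trans_eq heq)).trans
    (norm_cfcₙ_le fun t ht ↦ ?_)
  have ht0 := hspec t ht
  have h1 := hC t ht0
  rw [show t - t * g t - g t * (t - t * g t) = t * (1 - g t) ^ 2 by ring,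
    Real.norm_of_nonneg (by positivity)]
  exact h1

/-- If `star x * x ≤ a`, then `x` is a left multiple of `a ^ α` for every `0 < α < 1 / 2`. -/
theorem exists_eq_mul_nnrpow {x a : A} (ha : 0 ≤ a) (hxa : star x * x ≤ a) {α : ℝ≥0}
    (hα : 0 < α) (hα2 : α < 1 / 2) : ∃ u : A, x = u * a ^ α := by
  have hα' : (0 : ℝ) < α := hα
  have hα2' : (α : ℝ) < 1 / 2 := by exact_mod_cast hα2
  have hspec : ∀ t ∈ quasispectrum ℝ a, 0 ≤ t := fun t ht ↦
    quasispectrum_nonneg_of_nonneg a ha t ht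
  let δ : ℕ → ℝ := fun n ↦ 1 / ((n : ℝ) + 1)
  have hδ : ∀ n, 0 < δ n := fun n ↦ Nat.one_div_pos_of_nat
  have hδlim : Tendsto δ atTop (𝓝 0) := tendsto_one_div_add_atTop_nhds_zero_nat
  -- Regularizes `t ^ (-α)`; `u` is the limit of `x * g n (a)`.
  let g : ℕ → ℝ → ℝ := fun n t ↦ t ^ (1 - α : ℝ) / (t + δ n)
  have hgc : ∀ n, Continuous fun t : Set.Ici (0 : ℝ) ↦ g n t := fun n ↦ by
    refine Continuous.div ?_ (by fun_prop) fun t ↦ ?_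
    · exact (Real.continuous_rpow_const (by linarith)).comp continuous_subtype_val
    · have := t.2; have := hδ n; simp only [Set.mem_Ici] at *; linarith
  have hgc' : ∀ n, ContinuousOn (g n) (quasispectrum ℝ a) := fun n ↦
    (continuousOn_iff_continuous_domRestrict.2 (hgc n)).mono hspec
  have hg0 : ∀ n, g n 0 = 0 := fun n ↦ by
    simp [g, Real.zero_rpow (show (1 - α : ℝ) ≠ 0 by linarith)]
  have hβlim : Tendsto (fun n ↦ 2 * δ n ^ (1 / 2 - α : ℝ)) atTop (𝓝 0) := by
    have := (hδlim.rpow_const (p := (1 / 2 - α : ℝ)) (Or.inr (by linarith))).const_mul 2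
    rwa [Real.zero_rpow (by linarith), mul_zero] at this
  have hcauchy : CauchySeq fun n ↦ x * cfcₙ (g n) a := by
    refine cauchySeq_of_le_tendsto_0 _ (fun n m N hn hm ↦ ?_) hβlim
    rw [dist_eq_norm, ← mul_sub, ← cfcₙ_sub (g n) (g m) a (hgc' n) (hg0 n) (hgc' m) (hg0 m)]
    have hpos : 0 ≤ 2 * δ N ^ (1 / 2 - α : ℝ) := by have := hδ N; positivity
    refine le_of_sq_le_sq ?_ hpos
    refine norm_mul_cfcₙ_sq_le ha hxa ((hgc n).sub (hgc m)) (by simp [hg0]) fun t ht ↦ ?_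
    have hmono : ∀ k, N ≤ k → δ k ^ (1 / 2 - α : ℝ) ≤ δ N ^ (1 / 2 - α : ℝ) := fun k hk ↦
      Real.rpow_le_rpow (hδ k).le (Nat.one_div_le_one_div hk) (by linarith)
    have e1 := (Real.abs_sqrt_mul_rpow_div_sub_le ht (hδ n) hα' hα2').trans (hmono n hn)
    have e2 := (Real.abs_sqrt_mul_rpow_div_sub_le ht (hδ m) hα' hα2').trans (hmono m hm)
    rw [abs_le] at e1 e2
    have e3 : |√t * (g n t - g m t)| ≤ 2 * δ N ^ (1 / 2 - α : ℝ) := by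
      rw [abs_le, mul_sub]; constructor <;> simp only [g] <;> linarith
    calc t * (g n t - g m t) ^ 2 = (√t * (g n t - g m t)) ^ 2 := by
          rw [mul_pow, Real.sq_sqrt ht]
      _ ≤ _ := sq_le_sq.2 (by rwa [abs_of_nonneg hpos])
  obtain ⟨u, hu⟩ := cauchySeq_tendsto_of_complete hcauchy
  refine ⟨u, ?_⟩
  have hlim1 := hu.mul_const (a ^ α)
  refine tendsto_nhds_unique ?_ hlim1
  have hpow : ∀ n, x * cfcₙ (g n) a * a ^ α = x * cfcₙ (fun t ↦ t / (t + δ n)) a := fun n ↦ by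
    rw [CFC.nnrpow_eq_cfcₙ_real a α, mul_assoc, ← cfcₙ_mul (g n) (fun t : ℝ ↦ t ^ (α : ℝ)) a
      (hgc' n) (hg0 n) (Real.continuous_rpow_const hα'.le).continuousOn
      (Real.zero_rpow hα'.ne')]
    congr 1
    refine cfcₙ_congr fun t ht ↦ ?_
    simp only [g]
    rw [div_mul_eq_mul_div, ← Real.rpow_add_of_nonneg (hspec t ht) (by linarith) hα'.le]
    simp
  simp only [hpow]
  rw [tendsto_iff_norm_sub_tendsto_zero]
  have hsq : Tendsto (fun n ↦ √(δ n)) atTop (𝓝 0) := by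
    simpa [Function.comp_def] using (Real.continuous_sqrt.tendsto 0).comp hδlim
  refine squeeze_zero (fun _ ↦ norm_nonneg _) (fun n ↦ ?_) hsq
  rw [norm_sub_rev]
  refine Real.le_sqrt_of_sq_le (norm_sub_mul_cfcₙ_sq_le ha hxa ?_ (by simp) fun t ht ↦ ?_)
  · refine Continuous.div (by fun_prop) (by fun_prop) fun t ↦ ?_
    have := t.2; have := hδ n; simp only [Set.mem_Ici] at *; linarith
  · have hd := hδ n
    have h1 : 1 - t / (t + δ n) = δ n / (t + δ n) := by field_simp; ring
    rw [h1, div_pow, ← mul_div_assoc, div_le_iff₀ (by positivity)]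
    nlinarith [mul_nonneg ht hd.le, mul_pos hd hd, mul_nonneg (mul_nonneg ht hd.le) hd.le,
      mul_nonneg (mul_nonneg ht ht) hd.le, pow_pos hd 3]

end Factorization

end CStarAlgebra

/-! ### Semiprime ideals and powers -/

namespace TwoSidedIdeal

section Ring

variable {R : Type*} [NonUnitalRing R]

/-- The additive span of `ReR` squares into `I`, as `(xey)(x'ey') = x(e(yx')e)y'`. -/
lemma IsSemiprime.mul_mul_mem {I : TwoSidedIdeal R} (hI : I.IsSemiprime) {e : R}
    (he : ∀ x, e * x * e ∈ I) (x y : R) : x * e * y ∈ I := by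
  let S : Set R := {z | ∃ x y, x * e * y = z}
  let J : TwoSidedIdeal R := .mk' (AddSubgroup.closure S) (ZeroMemClass.zero_mem _) AddMemClass.add_mem
    NegMemClass.neg_mem
    (fun {r s} hs ↦ by
      induction hs using AddSubgroup.closure_induction with
      | mem s hs =>
        obtain ⟨x, y, rfl⟩ := hs
        exact AddSubgroup.subset_closure ⟨r * x, y, by simp only [mul_assoc]⟩
      | zero => simp
      | add s t _ _ hs ht => rw [mul_add]; exact AddMemClass.add_mem hs ht
      | neg s _ hs => rw [mul_neg]; exact NegMemClass.neg_mem hs)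
    (fun {s r} hs ↦ by
      induction hs using AddSubgroup.closure_induction with
      | mem s hs =>
        obtain ⟨x, y, rfl⟩ := hs
        exact AddSubgroup.subset_closure ⟨x, y * r, by simp only [mul_assoc]⟩
      | zero => simp
      | add s t _ _ hs ht => rw [add_mul]; exact AddMemClass.add_mem hs ht
      | neg s _ hs => rw [neg_mul]; exact NegMemClass.neg_mem hs)
  have hJ : ∀ z, z ∈ J ↔ z ∈ AddSubgroup.closure S := fun z ↦ mem_mk' ..
  have hle : J ≤ I := by
    refine hI J fun z hz ↦ ?_
    refine (AddSubgroup.closure_le (K := AddSubgroup.ofClass I)).2 ?_ hz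
    rintro _ ⟨s, hs, t, ht, rfl⟩
    rw [hJ] at hs ht
    change s * t ∈ I
    induction hs using AddSubgroup.closure_induction with
    | mem s hs =>
      obtain ⟨x, y, rfl⟩ := hs
      induction ht using AddSubgroup.closure_induction with
      | mem t ht =>
        obtain ⟨x', y', rfl⟩ := ht
        have := I.mul_mem_right _ y' (I.mul_mem_left x _ (he (y * x')))
        simpa only [mul_assoc] using this
      | zero => rw [mul_zero]; exact I.zero_mem
      | add s t _ _ hs ht => rw [mul_add]; exact I.add_mem hs ht
      | neg s _ hs => rw [mul_neg]; exact I.neg_mem hs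
    | zero => rw [zero_mul]; exact I.zero_mem
    | add s t _ _ hs ht => rw [add_mul]; exact I.add_mem hs ht
    | neg s _ hs => rw [neg_mul]; exact I.neg_mem hs
  exact hle ((hJ _).2 (AddSubgroup.subset_closure ⟨x, y, rfl⟩))

end Ring

section CStarAlgebra

variable {A : Type*} [NonUnitalCStarAlgebra A] [PartialOrder A] [StarOrderedRing A]
  {I : TwoSidedIdeal A}

lemma nnrpow_mul_mul_nnrpow_mem {d : A} (hd : 0 ≤ d) (hdI : d ∈ I) (x : A) :
    d ^ (5 / 8 : ℝ≥0) * x * d ^ (5 / 8 : ℝ≥0) ∈ I := by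
  set e := d ^ (5 / 8 : ℝ≥0) with he
  have he0 : 0 ≤ e := CFC.nnrpow_nonneg
  have hes : star e = e := (IsSelfAdjoint.of_nonneg he0).star_eq
  -- `I` need not be closed under scalars; `z` is absorbed into `u` in `u d u*`.
  have hpos : ∀ y : A, 0 ≤ y → ‖y‖ ≤ 1 → ∀ z : ℂ, z • (e * y * e) ∈ I := by
    intro y hy hy1 z
    have hc0 : 0 ≤ e * y * e := by simpa [hes] using star_left_conjugate_nonneg hy e
    have hee : e * e = d ^ (5 / 4 : ℝ≥0) := by
      rw [he, ← CFC.nnrpow_add (by norm_num) (by norm_num)]; norm_num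
    have hc : e * y * e ≤ d ^ (5 / 4 : ℝ≥0) := by
      have h1 : e * y * e ≤ ‖y‖ • (e * e) := by
        simpa only [hes] using
          CStarAlgebra.star_left_conjugate_le_norm_smul (a := e) (b := y)
            (IsSelfAdjoint.of_nonneg hy)
      refine h1.trans ?_
      rw [← hee]
      have h2 : 0 ≤ e * e := by simpa [hes] using star_mul_self_nonneg e
      simpa using smul_le_smul_of_nonneg_right hy1 h2
    have hs : star (CFC.sqrt (e * y * e)) = CFC.sqrt (e * y * e) :=
      (IsSelfAdjoint.of_nonneg (CFC.sqrt_nonneg _)).star_eq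
    have hss : CFC.sqrt (e * y * e) * CFC.sqrt (e * y * e) = e * y * e :=
      CFC.sqrt_mul_sqrt_self _ hc0
    -- The exponent `5/8 > 1/2` makes `2/5 < 1/2` suffice to reach `d^(1/2)`.
    obtain ⟨u, hu⟩ := CStarAlgebra.exists_eq_mul_nnrpow (x := CFC.sqrt (e * y * e))
      (a := d ^ (5 / 4 : ℝ≥0)) CFC.nnrpow_nonneg (by rwa [hs, hss])
      (α := 2 / 5) (by norm_num) (by rw [← NNReal.coe_lt_coe]; norm_num)
    have hexp : (5 / 4 * (2 / 5) : ℝ≥0) = 1 / 2 := by norm_num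
    rw [CFC.nnrpow_nnrpow, hexp] at hu
    have hds : star (d ^ (1 / 2 : ℝ≥0)) = d ^ (1 / 2 : ℝ≥0) :=
      (IsSelfAdjoint.of_nonneg CFC.nnrpow_nonneg).star_eq
    have hdd : d ^ (1 / 2 : ℝ≥0) * d ^ (1 / 2 : ℝ≥0) = d := by
      rw [← CFC.nnrpow_add (by norm_num) (by norm_num), add_halves, CFC.nnrpow_one d]
    have hfin : e * y * e = u * d * star u := by
      calc e * y * e = CFC.sqrt (e * y * e) * star (CFC.sqrt (e * y * e)) := by rw [hs, hss]
        _ = u * (d ^ (1 / 2 : ℝ≥0) * d ^ (1 / 2 : ℝ≥0)) * star u := by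
          rw [hu, star_mul, hds]; simp only [mul_assoc]
        _ = _ := by rw [hdd]
    rw [hfin, ← smul_mul_assoc, ← smul_mul_assoc]
    exact I.mul_mem_right _ _ (I.mul_mem_left _ _ hdI)
  have hx : x ∈ Submodule.span ℂ ({x : A | 0 ≤ x} ∩ Metric.closedBall 0 1) := by
    rw [CStarAlgebra.span_nonneg_inter_unitClosedBall]; trivial
  suffices ∀ z : ℂ, z • (e * x * e) ∈ I by simpa using this 1
  induction hx using Submodule.span_induction with
  | mem y hy => exact hpos y hy.1 (by simpa using hy.2)
  | zero => simp [I.zero_mem]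
  | add y y' _ _ h h' => intro z; rw [mul_add, add_mul, smul_add]; exact I.add_mem (h z) (h' z)
  | smul w y _ h => intro z; rw [mul_smul_comm, smul_mul_assoc, smul_smul]; exact h _

lemma IsSemiprime.nnrpow_three_quarters_mem (hI : I.IsSemiprime) {d : A} (hd : 0 ≤ d)
    (hdI : d ∈ I) : d ^ (3 / 4 : ℝ≥0) ∈ I := by
  -- `1/16 + 5/8 + 1/16 = 3/4`.
  have h := hI.mul_mul_mem (nnrpow_mul_mul_nnrpow_mem hd hdI) (d ^ (1 / 16 : ℝ≥0))
    (d ^ (1 / 16 : ℝ≥0))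
  rw [← CFC.nnrpow_add (by norm_num) (by norm_num), ← CFC.nnrpow_add (by norm_num) (by norm_num)]
    at h
  convert h using 2
  norm_num

/-- A semiprime ideal contains all positive powers of its positive elements. -/
theorem IsSemiprime.nnrpow_mem (hI : I.IsSemiprime) {d : A} (hd : 0 ≤ d) (hdI : d ∈ I) {s : ℝ≥0}
    (hs : 0 < s) : d ^ s ∈ I := by
  have hpow : ∀ n : ℕ, d ^ ((3 / 4 : ℝ≥0) ^ n) ∈ I := fun n ↦ by
    induction n with
    | zero => rwa [pow_zero, CFC.nnrpow_one d]
    | succ n ih =>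
      rw [pow_succ, ← CFC.nnrpow_nnrpow]
      exact hI.nnrpow_three_quarters_mem CFC.nnrpow_nonneg ih
  obtain ⟨n, hn⟩ := exists_pow_lt_of_lt_one hs
    (show (3 / 4 : ℝ≥0) < 1 by rw [← NNReal.coe_lt_coe]; norm_num)
  rw [← add_tsub_cancel_of_le hn.le, CFC.nnrpow_add (by positivity) (tsub_pos_of_lt hn)]
  exact I.mul_mem_right _ _ (hpow n)

theorem IsSemiprime.mem_of_mul_star_mul_mem (hI : I.IsSemiprime) {b : A}
    (hb : b * (star b * b) ∈ I) : b ∈ I := by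
  have h0 : 0 ≤ star b * b := star_mul_self_nonneg b
  have hsq : (star b * b) ^ (2 : ℝ≥0) ∈ I := by
    rw [CFC.nnrpow_two _ h0, mul_assoc]
    exact I.mul_mem_left _ _ hb
  have h4 := hI.nnrpow_mem CFC.nnrpow_nonneg hsq (s := 1 / 8) (by norm_num)
  rw [CFC.nnrpow_nnrpow, show (2 * (1 / 8) : ℝ≥0) = 1 / 4 by norm_num] at h4
  obtain ⟨u, hu⟩ := CStarAlgebra.exists_eq_mul_nnrpow h0 le_rfl (α := 1 / 4) (by norm_num)
    (by rw [← NNReal.coe_lt_coe]; norm_num)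
  rw [hu]
  exact I.mul_mem_left _ _ h4

end CStarAlgebra

end TwoSidedIdeal

/-- `I ∩ B`, regarded as a subset of `B`, is the preimage of `I` under the inclusion `B → A`;
a C⋆-subalgebra is a norm-closed (not necessarily unital) ⋆-subalgebra. -/
theorem proposition4p11 {A : Type*} [NonUnitalCStarAlgebra A]
    (I : TwoSidedIdeal A) (hI : I.IsSemiprime)
    (B : NonUnitalStarSubalgebra ℂ A) (hB : IsClosed (B : Set A)) :
    ∃ J : TwoSidedIdeal B, (J : Set B) = {b : B | (b : A) ∈ I} ∧ J.IsSemiprime := by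
  let _ := CStarAlgebra.spectralOrder A
  have _ := CStarAlgebra.spectralOrderedRing A
  refine ⟨I.comap (NonUnitalStarSubalgebraClass.subtype B), ?_, fun K hK b hb ↦ ?_⟩
  · ext b
    exact TwoSidedIdeal.mem_comap _
  -- `K` need not be self-adjoint, but `b*b ∈ K` since `b ∈ K`.
  · have hmem : b * (star b * b) ∈ K.prodAddSubgroup K :=
      AddSubgroup.subset_closure ⟨b, hb, star b * b, K.mul_mem_left _ _ hb, rfl⟩
    have h := (TwoSidedIdeal.mem_comap _).1 (hK hmem)
    exact (TwoSidedIdeal.mem_comap _).2 (hI.mem_of_mul_star_mul_mem h)
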